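/- Conventions. Let $(X,d,\mu)$ and $(X',d',\mu')$ be metric spaces with locally finite Borel measures. A domain is an open path connected set. Let $D\subset X$ and $D'\subset X'$ be domains with finite Hausdorff dimensions $\alpha$ and $\alpha'$. For a family $\Gamma$ of paths (continuous maps of a compact interval) in $D$, a Borel function $\varrho:X\to[0,\infty]$ is admissible, $\varrho\in\operatorname{adm}\Gamma$, if $\int_\gamma\varrho\,ds\ge1$ for every rectifiable $\gamma\in\Gamma$ (integration with respect to arc length), and the modulus is $$M(\Gamma)=\inf_{\varrho\in\operatorname{adm}\Gamma}\int_D\varrho^{\alpha}\,d\mu ;$$ for families of paths in $D'$ one uses $D'$, $\alpha'$ and $\mu'$ instead. Let $Q:D\to[0,\infty]$ be a measurable function. A homeomorphism $f:D\to D'$ is a $Q$-homeomorphism if $$M(f\Gamma)\le\int_D Q\,\varrho^{\alpha}\,d\mu$$ for every family $\Gamma$ of paths in $D$ and every $\varrho\in\operatorname{adm}\Gamma$. The boundary $\partial D'$ is strongly accessible if for every $y_0\in\partial D'$ and every neighborhood $U$ of $y_0$ there are a compact set $E\subset D'$, a neighborhood $V\subset U$ of $y_0$ and a number $\delta>0$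 such that $M(\Delta(E,F;D'))\ge\delta$ for every continuum (compact connected set) $F\subset D'$ that meets $\partial U$ and $\partial V$, where $\Delta(E,F;D')$ is the family of all paths in $D'$ that join $E$ and $F$. The domain $D$ is locally path connected at $x_0\in\partial D$ if every neighborhood $U$ of $x_0$ contains a neighborhood $V$ of $x_0$ such that $V\cap D$ is path connected. The space $X$ is upper $\lambda(r)$-regular at $x_0$ if there are $C>0$ and $r_0>0$ such that $\lambda$ is increasing (not necessarily strictly) on $(0,r_0)$ and $\mu(B(x_0,r))\le C\lambda(r)$ for $0<r<r_0$. Theorem. Let $x_0\in\partial D$, let $D$ be locally path connected at $x_0$, and let $X$ be upper $\lambda(r)$-regular at $x_0$ for a function $\lambda$ with $$\lambda(\varepsilon)=o\left(\varepsilon^{\alpha}\log^{\alpha-1}\frac1\varepsilon\right)\qquad(\varepsilon\to0).$$ Let $\overline{D'}$ be compact and $\partial D'$ strongly accessible. If $$\limsup_{\varepsilon\to0}\frac{1}{\mu(B(x_0,\varepsilon)\cap D)}\int_{B(x_0,\varepsilon)\cap D}Q\,d\mu<\infty$$ (the quotient being read as $0$ where $\mu(B(x_0,\varepsilon)\cap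 D)=0$), then every $Q$-homeomorphism $f:D\to D'$ extends to a continuous map $D\cup\{x_0\}\to X'$. -/

import Mathlib

open Set Filter Topology MeasureTheory Asymptotics
open scoped ENNReal NNReal unitInterval

/-- A domain: an open, path connected set. -/
def IsDomainSet {X : Type*} [TopologicalSpace X] (D : Set X) : Prop :=
  IsOpen D ∧ IsPathConnected D

/-- The length of a path `γ : [0,1] → X`: the supremum of the sums of the distances of consecutive
points over all partitions of the parameter interval. -/
noncomputable def pathLength {X : Type*} [MetricSpace X] (γ : I → X) : ℝ≥0∞ :=
  eVariationOn γ univ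

/-- The line integral of `ρ : X → [0,∞]` along a rectifiable path with respect to arc length:
the integral over `[0, length γ]` of `ρ` composed with the arc length parametrization of `γ`.
It is used for rectifiable continuous paths only. -/
noncomputable def lineIntegral {X : Type*} [MetricSpace X] (ρ : X → ℝ≥0∞) (γ : I → X) : ℝ≥0∞ :=
  ∫⁻ s in Icc (0 : ℝ) (pathLength γ).toReal, ρ (naturalParameterization γ univ 0 s)

/-- `ρ` is admissible for a family `Γ` of paths in `D`: it is a Borel function `X → [0,∞]` whose
line integral is at least `1` along every path of `Γ`. As usual, the line integral exists along
rectifiable paths, and the other paths impose no condition. -/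
def Admissible {X : Type*} [MetricSpace X] [MeasurableSpace X] {D : Set X}
    (Γ : Set C(I, D)) (ρ : X → ℝ≥0∞) : Prop :=
  Measurable ρ ∧
    ∀ γ ∈ Γ, pathLength (fun t => (γ t : X)) < ⊤ → 1 ≤ lineIntegral ρ (fun t => (γ t : X))

/-- The modulus of a family of paths in `D`, whose exponent is the Hausdorff dimension of `D`. -/
noncomputable def pathModulus {X : Type*} [MetricSpace X] [MeasurableSpace X] (μ : Measure X)
    {D : Set X} (Γ : Set C(I, D)) : ℝ≥0∞ :=
  ⨅ (ρ : X → ℝ≥0∞) (_ : Admissible Γ ρ), ∫⁻ x in D, ρ x ^ (dimH D).toReal ∂μ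

/-- The family of all paths in `D` that start in `E` and end in `F`. -/
def joiningPaths {X : Type*} [TopologicalSpace X] (E F D : Set X) : Set C(I, D) :=
  {γ | (γ 0 : X) ∈ E ∧ (γ 1 : X) ∈ F}

/-- A homeomorphism `f : D → D'` is a `Q`-homeomorphism if the modulus of the image family of every
family `Γ` of paths in `D` is at most `∫_D Q ρ ^ α dμ` for every `ρ` admissible for `Γ`, where `α` is
the Hausdorff dimension of `D`. Only the values of `Q` on `D` matter. -/
def IsQHomeomorphism {X X' : Type*} [MetricSpace X] [MeasurableSpace X]
    [MetricSpace X'] [MeasurableSpace X'] (μ : Measure X) (μ' : Measure X')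
    {D : Set X} {D' : Set X'} (Q : X → ℝ≥0∞) (f : D ≃ₜ D') : Prop :=
  ∀ (Γ : Set C(I, D)) (ρ : X → ℝ≥0∞), Admissible Γ ρ →
    pathModulus μ' ((fun γ : C(I, D) => (f : C(D, D')).comp γ) '' Γ) ≤
      ∫⁻ x in D, Q x * ρ x ^ (dimH D).toReal ∂μ

/-- The space is upper `lam(r)`-regular at `x₀`: on some interval `(0, r₀)` the function `lam` is
increasing, and `μ (B(x₀, r)) ≤ C * lam r` there. -/
def UpperRegularAt {X : Type*} [MetricSpace X] [MeasurableSpace X] (μ : Measure X)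
    (lam : ℝ → ℝ) (x₀ : X) : Prop :=
  ∃ C > (0 : ℝ), ∃ r₀ > (0 : ℝ), MonotoneOn lam (Ioo 0 r₀) ∧
    ∀ r ∈ Ioo 0 r₀, μ (Metric.ball x₀ r) ≤ ENNReal.ofReal (C * lam r)

/-- `D` is locally path connected at a boundary point `x₀`. -/
def LocallyPathConnectedAt {X : Type*} [TopologicalSpace X] (D : Set X) (x₀ : X) : Prop :=
  ∀ U ∈ 𝓝 x₀, ∃ V ∈ 𝓝 x₀, V ⊆ U ∧ IsPathConnected (V ∩ D)

/-- The boundary of `D` is strongly accessible at a boundary point `x₀`. -/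
def StronglyAccessibleAt {X : Type*} [MetricSpace X] [MeasurableSpace X] (μ : Measure X)
    (D : Set X) (x₀ : X) : Prop :=
  ∀ U ∈ 𝓝 x₀, ∃ E ⊆ D, IsCompact E ∧ ∃ V ∈ 𝓝 x₀, V ⊆ U ∧ ∃ δ > (0 : ℝ≥0∞),
    ∀ F ⊆ D, IsCompact F → IsConnected F → (F ∩ frontier U).Nonempty →
      (F ∩ frontier V).Nonempty → δ ≤ pathModulus μ (joiningPaths E F D)

/-- The boundary of `D` is strongly accessible at all of its points. -/
def StronglyAccessibleBoundary {X : Type*} [MetricSpace X] [MeasurableSpace X] (μ : Measure X)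
    (D : Set X) : Prop :=
  ∀ x₀ ∈ frontier D, StronglyAccessibleAt μ D x₀

/-! Since `closure D'` is compact, `f` extends continuously to `x₀` once it has a single cluster
point there. Cluster points lie in `frontier D'`. If `y ≠ z` were two of them, images of curves in
`D` arbitrarily close to `x₀` would run from near `y` to near `z`, and strong accessibility at `y`
would bound below the modulus of the paths joining them to a fixed compact `E`.

The `Q`-inequality contradicts this. The preimages of these paths cross a ring around `x₀`
(`lintegral_le_lineIntegral_radial`), and a discretized form of `1 / (t log (1/t))` is admissible
for such crossings. Bounded means of `Q` and the growth of `lam` bound the `Q`-mass of small balls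
by `η ε^a log(1/ε)^(a-1)` with any `η > 0`, so the ring of radius about `e^{-k}` has energy of order
`η/k`. After normalization by the harmonic sum the total is as small as desired
(`exists_radial_density`). -/

theorem continuous_variationOnFromTo {α E : Type*} [LinearOrder α] [TopologicalSpace α]
    [OrderTopology α] [PseudoMetricSpace E] {γ : α → E} (hγ : Continuous γ)
    (hbv : BoundedVariationOn γ univ) (a : α) : Continuous (variationOnFromTo γ univ a) := by
  have hloc := hbv.locallyBoundedVariationOn
  refine continuous_iff_continuousAt.2 fun b => ?_
  refine continuousAt_iff_continuous_left'_right'.2 ⟨?_, ?_⟩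
  · have := variationOnFromTo.tendsto_left (mem_univ a) (mem_univ b) hloc
      (hγ.continuousAt.tendsto.mono_left nhdsWithin_le_nhds)
    simpa [ContinuousWithinAt] using this
  · have := variationOnFromTo.tendsto_right (mem_univ a) (mem_univ b) hloc
      (hγ.continuousAt.tendsto.mono_left nhdsWithin_le_nhds)
    simpa [ContinuousWithinAt] using this

/-- A chord is no longer than its arc, and the parameter is arc length. -/
theorem lipschitzOnWith_naturalParameterization {α E : Type*} [LinearOrder α]
    [PseudoEMetricSpace E] {γ : α → E} {s : Set α} (hγ : LocallyBoundedVariationOn γ s) {a : α}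
    (ha : a ∈ s) :
    LipschitzOnWith 1 (naturalParameterization γ s a) (variationOnFromTo γ s a '' s) := by
  intro x hx y hy
  wlog hxy : x ≤ y generalizing x y
  · rw [edist_comm, edist_comm x]
    exact this hy hx (le_of_not_ge hxy)
  calc edist (naturalParameterization γ s a x) (naturalParameterization γ s a y)
      ≤ eVariationOn (naturalParameterization γ s a)
          (variationOnFromTo γ s a '' s ∩ Icc x y) :=
        eVariationOn.edist_le _ ⟨hx, le_rfl, hxy⟩ ⟨hy, hxy, le_rfl⟩
    _ = ENNReal.ofReal (y - x) := by
        rw [has_unit_speed_naturalParameterization γ hγ ha hx hy]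
        simp
    _ = (1 : ℝ≥0) * edist x y := by
        rw [edist_comm, edist_dist, Real.dist_eq, abs_of_nonneg (sub_nonneg.2 hxy)]
        simp

/-- A real function that is `1`-Lipschitz on an interval pushes Lebesgue measure forward to a
measure that dominates Lebesgue measure between its values at the endpoints. -/
theorem volume_restrict_le_map_of_lipschitzOnWith {h : ℝ → ℝ} {L r R : ℝ} (hL : 0 ≤ L)
    (hh : LipschitzOnWith 1 h (Icc 0 L)) (h0 : R ≤ h 0) (h1 : h L ≤ r) :
    volume.restrict (Ioo r R) ≤ Measure.map h (volume.restrict (Icc 0 L)) := by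
  have hm : AEMeasurable h (volume.restrict (Icc 0 L)) :=
    hh.continuousOn.aemeasurable measurableSet_Icc
  refine Measure.le_iff.2 fun A hA => ?_
  rw [Measure.map_apply_of_aemeasurable hm hA, Measure.restrict_apply hA,
    Measure.restrict_apply' measurableSet_Icc]
  have hsub : A ∩ Ioo r R ⊆ h '' (h ⁻¹' A ∩ Icc 0 L) := by
    rintro t ⟨htA, ht⟩
    obtain ⟨s, hs, rfl⟩ := intermediate_value_Icc' hL hh.continuousOn
      ⟨h1.trans ht.1.le, ht.2.le.trans h0⟩
    exact ⟨s, ⟨htA, hs⟩, rfl⟩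
  refine (measure_mono hsub).trans ?_
  -- On the line, Lebesgue measure is one-dimensional Hausdorff measure, which a `1`-Lipschitz map
  -- does not increase.
  have := (hh.mono inter_subset_right).hausdorffMeasure_image_le (s := h ⁻¹' A ∩ Icc 0 L)
    zero_le_one
  simpa [hausdorffMeasure_real] using this

/-- The line integral of a radial density along a path that crosses a spherical ring is at least
the integral of the density over the range of the radii. -/
theorem lintegral_le_lineIntegral_radial {X : Type*} [MetricSpace X] {γ : I → X}
    (hγ : Continuous γ) (hlen : pathLength γ < ⊤) (x₀ : X) {r R : ℝ} (h0 : R ≤ dist (γ 0) x₀)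
    (h1 : dist (γ 1) x₀ ≤ r) {g : ℝ → ℝ≥0∞} (hg : Measurable g) :
    ∫⁻ t in Ioo r R, g t ≤ lineIntegral (fun x => g (dist x x₀)) γ := by
  have hbv : BoundedVariationOn γ univ := hlen.ne
  have hloc := hbv.locallyBoundedVariationOn
  set v := variationOnFromTo γ univ (0 : I) with hv
  have hv0 : v 0 = 0 := variationOnFromTo.self _ _ _
  have hv1 : v 1 = (pathLength γ).toReal := by
    rw [hv, variationOnFromTo.eq_of_le _ _ zero_le_one, pathLength]
    congr 2
    ext t
    simpa using unitInterval.le_one'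
  -- Continuity of arc length rules out gaps in its range, outside of which the natural
  -- parameterization has no meaning.
  have hsub : Icc 0 (pathLength γ).toReal ⊆ v '' univ := by
    rw [image_univ, ← hv0, ← hv1]
    exact intermediate_value_univ _ _ (continuous_variationOnFromTo hγ hbv 0)
  have hend : ∀ t, naturalParameterization γ univ 0 (v t) = γ t := fun t =>
    edist_eq_zero.1 (edist_naturalParameterization_eq_zero hloc (mem_univ _) (mem_univ _))
  have hlip : LipschitzOnWith 1 (fun s => dist (naturalParameterization γ univ 0 s) x₀)
      (Icc 0 (pathLength γ).toReal) := by
    simpa [Function.comp_def] using (LipschitzWith.dist_left x₀).comp_lipschitzOnWith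
      ((lipschitzOnWith_naturalParameterization hloc (mem_univ (0 : I))).mono hsub)
  have hle := volume_restrict_le_map_of_lipschitzOnWith (r := r) (R := R) ENNReal.toReal_nonneg hlip
    (by rw [← hv0, hend]; exact h0) (by rw [← hv1, hend]; exact h1)
  calc ∫⁻ t in Ioo r R, g t
      ≤ ∫⁻ t, g t ∂(Measure.map (fun s => dist (naturalParameterization γ univ 0 s) x₀)
          (volume.restrict (Icc 0 (pathLength γ).toReal))) := lintegral_mono' hle le_rfl
    _ = lineIntegral (fun x => g (dist x x₀)) γ :=
        lintegral_map' hg.aemeasurable (hlip.continuousOn.aemeasurable measurableSet_Icc)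

/-- The distance to a point is `1`-Lipschitz and maps the set onto a superset of an interval. The
energy estimate needs this exponent bound. -/
theorem IsPreconnected.one_le_dimH {X : Type*} [MetricSpace X] {D : Set X}
    (hD : IsPreconnected D) (hnt : D.Nontrivial) : 1 ≤ dimH D := by
  obtain ⟨p, hp, q, hq, hpq⟩ := hnt
  have himg : Icc 0 (dist q p) ⊆ (fun x => dist x p) '' D := by
    have := (hD.image (fun x => dist x p) (by fun_prop)).Icc_subset
      (mem_image_of_mem _ hp) (mem_image_of_mem _ hq)
    simpa using this
  calc (1 : ℝ≥0∞) = dimH (Icc 0 (dist q p)) := by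
        rw [Real.dimH_of_nonempty_interior]
        · simp
        · rw [interior_Icc]
          exact nonempty_Ioo.2 (dist_pos.2 hpq.symm)
    _ ≤ dimH ((fun x => dist x p) '' D) := dimH_mono himg
    _ ≤ dimH D := (LipschitzWith.dist_left p).dimH_image_le D

/-! ### Radial densities of small energy -/

/-- Height to the power `a` times the mass bound of the ball of radius `r = e^{-k}`: the powers of
`r` cancel and those of `k` leave `1 / k`. The rest is `S ≤ S ^ a`. -/
theorem annulus_height_mul_bound {a η S k r : ℝ} (ha : 1 ≤ a) (hη : 0 ≤ η) (hS : 1 ≤ S)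
    (hk : 0 < k) (hr : 0 < r) :
    (2 / (S * k * r)) ^ a * (η * (r ^ a * k ^ (a - 1))) ≤ η * 2 ^ a / S * (1 / k) := by
  have hS0 : 0 < S := by linarith
  have hra := Real.rpow_pos_of_pos hr a
  have hka := Real.rpow_pos_of_pos hk a
  have hSa := Real.rpow_pos_of_pos hS0 a
  have h2a : (0 : ℝ) < 2 ^ a := by positivity
  rw [Real.div_rpow (by norm_num) (by positivity), Real.mul_rpow (by positivity) hr.le,
    Real.mul_rpow hS0.le hk.le, Real.rpow_sub_one hk.ne']
  have : 2 ^ a / (S ^ a * k ^ a * r ^ a) * (η * (r ^ a * (k ^ a / k)))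
      = η * 2 ^ a / S ^ a * (1 / k) := by
    field_simp
  rw [this]
  gcongr
  exact Real.self_le_rpow_of_one_le hS ha

theorem exists_one_le_sum_Ico_inv (m : ℕ) :
    ∃ N, m < N ∧ (1 : ℝ) ≤ ∑ k ∈ Finset.Ico m N, 1 / (k : ℝ) := by
  have h : Tendsto (fun n : ℕ => ∑ k ∈ Finset.range n, 1 / (k : ℝ)) atTop atTop :=
    not_summable_iff_tendsto_nat_atTop_of_nonneg (fun n => by positivity) |>.1
      Real.not_summable_one_div_natCast
  obtain ⟨N, hN, hmN⟩ := ((h.eventually_ge_atTop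
    (1 + ∑ k ∈ Finset.range m, 1 / (k : ℝ))).and (eventually_gt_atTop m)).exists
  refine ⟨N, hmN, ?_⟩
  rw [Finset.sum_Ico_eq_sub _ hmN.le]
  linarith

/-- A function that is constant on finitely many consecutive rings, evaluated to a power. -/
theorem sum_indicator_Ioo_rpow_le {r : ℕ → ℝ} (hr : Antitone r) (c : ℕ → ℝ≥0∞) (s : Finset ℕ)
    {a : ℝ} (ha : 0 < a) (t : ℝ) :
    (∑ k ∈ s, (Ioo (r (k + 1)) (r k)).indicator (fun _ => c k) t) ^ a ≤
      ∑ k ∈ s, (Ioo (r (k + 1)) (r k)).indicator (fun _ => c k ^ a) t := by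
  by_cases h : ∃ j ∈ s, t ∈ Ioo (r (j + 1)) (r j)
  · obtain ⟨j, hj, ht⟩ := h
    have huniq : ∀ k, k ≠ j → t ∉ Ioo (r (k + 1)) (r k) := by
      intro k hkj htk
      rcases lt_or_gt_of_ne hkj with hlt | hlt
      · exact absurd (hr (Nat.succ_le_of_lt hlt)) (not_le.2 (htk.1.trans ht.2))
      · exact absurd (hr (Nat.succ_le_of_lt hlt)) (not_le.2 (ht.1.trans htk.2))
    rw [Finset.sum_eq_single_of_mem j hj
      fun k _ hk => indicator_of_notMem (huniq k hk) _, indicator_of_mem ht]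
    calc c j ^ a = (Ioo (r (j + 1)) (r j)).indicator (fun _ => c j ^ a) t :=
          (indicator_of_mem ht (fun _ => c j ^ a)).symm
      _ ≤ _ := Finset.single_le_sum
          (f := fun k => (Ioo (r (k + 1)) (r k)).indicator (fun _ => c k ^ a) t)
          (fun _ _ => zero_le) hj
  · push Not at h
    rw [Finset.sum_eq_zero fun k hk => indicator_of_notMem (h k hk) _,
      ENNReal.zero_rpow_of_pos ha]
    exact zero_le

/-- If the integral of `Q` over small balls is controlled by a small multiple of
`ε ^ a * log (1 / ε) ^ (a - 1)`, then there are radial densities of small weighted energy that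
are admissible for the crossings of some ring. -/
theorem exists_radial_density {X : Type*} [MetricSpace X] [MeasurableSpace X] [BorelSpace X]
    {ν : Measure X} {x₀ : X} {Q : X → ℝ≥0∞} (hQ : AEMeasurable Q ν) {a : ℝ} (ha : 1 ≤ a)
    (hsmall : ∀ η > (0 : ℝ), ∀ᶠ ε in 𝓝[>] (0 : ℝ), ∫⁻ x in Metric.ball x₀ ε, Q x ∂ν ≤
      ENNReal.ofReal (η * (ε ^ a * Real.log (1 / ε) ^ (a - 1))))
    {δ : ℝ≥0∞} (hδ : 0 < δ) {R : ℝ} (hR : 0 < R) :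
    ∃ r > (0 : ℝ), ∃ g : ℝ → ℝ≥0∞, Measurable g ∧ 1 ≤ ∫⁻ t in Ioo r R, g t ∧
      ∫⁻ x, Q x * g (dist x x₀) ^ a ∂ν < δ := by
  obtain ⟨δ', hδ'0, hδ'⟩ := ENNReal.lt_iff_exists_nnreal_btwn.1 hδ
  have hδ'pos : (0 : ℝ) < δ' := by exact_mod_cast hδ'0
  -- The ring bounds `η * 2 ^ a / S * (1 / k)` then add up to exactly `δ'`.
  set η : ℝ := δ' / 2 ^ a with hη
  have hηpos : 0 < η := by positivity
  set r : ℕ → ℝ := fun k => Real.exp (-k) with hr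
  have hrpos : ∀ k, 0 < r k := fun k => Real.exp_pos _
  have hranti : Antitone r := fun i j hij => Real.exp_le_exp.2 (by simpa using hij)
  have hrlim : Tendsto r atTop (𝓝[>] 0) := by
    refine tendsto_nhdsWithin_iff.2 ⟨?_, Eventually.of_forall hrpos⟩
    exact Real.tendsto_exp_neg_atTop_nhds_zero.comp tendsto_natCast_atTop_atTop
  have hev : ∀ᶠ k in atTop, (∫⁻ x in Metric.ball x₀ (r k), Q x ∂ν ≤
      ENNReal.ofReal (η * (r k ^ a * (k : ℝ) ^ (a - 1)))) ∧ r k < R := by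
    filter_upwards [hrlim.eventually (hsmall η hηpos),
      (tendsto_nhds_of_tendsto_nhdsWithin hrlim).eventually_lt_const hR] with k hk hkR
    refine ⟨?_, hkR⟩
    have hlog : Real.log (1 / r k) = k := by simp [hr]
    rwa [hlog] at hk
  obtain ⟨m, hm⟩ := eventually_atTop.1 (hev.and (eventually_ge_atTop 1))
  obtain ⟨N, hmN, hS⟩ := exists_one_le_sum_Ico_inv m
  set S : ℝ := ∑ k ∈ Finset.Ico m N, 1 / (k : ℝ) with hSdef
  have hS0 : 0 < S := by linarith
  -- Here `k = log (1 / r k)`. The factor `2` offsets the ring width, which is at least `r k / 2`,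
  -- so ring `k` contributes at least `1 / (k * S)` to the line integral.
  set c : ℕ → ℝ := fun k => 2 / (S * k * r k) with hc
  have hkpos : ∀ k ∈ Finset.Ico m N, (0 : ℝ) < k := fun k hk => by
    have := (hm k (Finset.mem_Ico.1 hk).1).2
    exact_mod_cast this
  refine ⟨r N, hrpos N, fun t => ∑ k ∈ Finset.Ico m N,
    (Ioo (r (k + 1)) (r k)).indicator (fun _ => ENNReal.ofReal (c k)) t, ?_, ?_, ?_⟩
  · exact Finset.measurable_fun_sum _ fun k _ => measurable_const.indicator measurableSet_Ioo
  · rw [lintegral_finsetSum _ fun k _ => measurable_const.indicator measurableSet_Ioo]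
    have hterm : ∀ k ∈ Finset.Ico m N, ENNReal.ofReal (1 / k / S) ≤
        ∫⁻ t in Ioo (r N) R, (Ioo (r (k + 1)) (r k)).indicator
          (fun _ => ENNReal.ofReal (c k)) t := by
      intro k hk
      have hk0 := hkpos k hk
      obtain ⟨hmk, hkN⟩ := Finset.mem_Ico.1 hk
      have hsub : Ioo (r (k + 1)) (r k) ⊆ Ioo (r N) R :=
        Ioo_subset_Ioo (hranti hkN) (hm k hmk).1.2.le
      rw [lintegral_indicator measurableSet_Ioo, Measure.restrict_restrict measurableSet_Ioo,
        inter_eq_left.2 hsub, lintegral_const, Measure.restrict_apply_univ, Real.volume_Ioo,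
        ← ENNReal.ofReal_mul (by positivity)]
      refine ENNReal.ofReal_le_ofReal ?_
      have hhalf : r (k + 1) ≤ r k / 2 := by
        have h2 : (2 : ℝ) ≤ Real.exp 1 := by linarith [Real.add_one_le_exp 1]
        have hmul : r (k + 1) * Real.exp 1 = r k := by
          rw [hr]
          simp only
          rw [← Real.exp_add]
          push_cast
          ring_nf
        nlinarith [hrpos (k + 1)]
      calc 1 / (k : ℝ) / S = c k * (r k / 2) := by
            rw [hc]
            have := (hrpos k).ne'
            field_simp
        _ ≤ c k * (r k - r (k + 1)) := by
            have : 0 ≤ c k := by positivity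
            gcongr
            linarith
    calc (1 : ℝ≥0∞) = ENNReal.ofReal (∑ k ∈ Finset.Ico m N, 1 / (k : ℝ) / S) := by
          rw [← Finset.sum_div, ← hSdef, div_self hS0.ne', ENNReal.ofReal_one]
      _ = ∑ k ∈ Finset.Ico m N, ENNReal.ofReal (1 / (k : ℝ) / S) :=
          ENNReal.ofReal_sum_of_nonneg fun k _ => by positivity
      _ ≤ _ := Finset.sum_le_sum hterm
  · refine lt_of_le_of_lt ?_ hδ'
    have hterm : ∀ k ∈ Finset.Ico m N,
        ∫⁻ x, Q x * (Ioo (r (k + 1)) (r k)).indicator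
          (fun _ => ENNReal.ofReal (c k) ^ a) (dist x x₀) ∂ν ≤
        ENNReal.ofReal (η * 2 ^ a / S * (1 / k)) := by
      intro k hk
      have hk0 := hkpos k hk
      have hrk := hrpos k
      have hck : 0 < c k := by positivity
      calc ∫⁻ x, Q x * (Ioo (r (k + 1)) (r k)).indicator
            (fun _ => ENNReal.ofReal (c k) ^ a) (dist x x₀) ∂ν
          ≤ ∫⁻ x, (Metric.ball x₀ (r k)).indicator
              (fun x => ENNReal.ofReal (c k ^ a) * Q x) x ∂ν := by
            refine lintegral_mono fun x => ?_
            by_cases hx : dist x x₀ ∈ Ioo (r (k + 1)) (r k)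
            · rw [indicator_of_mem hx, indicator_of_mem (Metric.mem_ball.2 hx.2), mul_comm,
                ENNReal.ofReal_rpow_of_pos hck]
            · rw [indicator_of_notMem hx, mul_zero]
              exact zero_le
        _ = ENNReal.ofReal (c k ^ a) * ∫⁻ x in Metric.ball x₀ (r k), Q x ∂ν := by
            rw [lintegral_indicator Metric.isOpen_ball.measurableSet,
              lintegral_const_mul' _ _ ENNReal.ofReal_ne_top]
        _ ≤ ENNReal.ofReal (c k ^ a) * ENNReal.ofReal (η * (r k ^ a * (k : ℝ) ^ (a - 1))) := by
            gcongr
            exact (hm k (Finset.mem_Ico.1 hk).1).1.1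
        _ ≤ ENNReal.ofReal (η * 2 ^ a / S * (1 / k)) := by
            rw [← ENNReal.ofReal_mul (by positivity)]
            exact ENNReal.ofReal_le_ofReal (annulus_height_mul_bound ha hηpos.le hS hk0 hrk)
    calc ∫⁻ x, Q x * (∑ k ∈ Finset.Ico m N, (Ioo (r (k + 1)) (r k)).indicator
            (fun _ => ENNReal.ofReal (c k)) (dist x x₀)) ^ a ∂ν
        ≤ ∫⁻ x, ∑ k ∈ Finset.Ico m N, Q x * (Ioo (r (k + 1)) (r k)).indicator
            (fun _ => ENNReal.ofReal (c k) ^ a) (dist x x₀) ∂ν := by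
          refine lintegral_mono fun x => ?_
          rw [← Finset.mul_sum]
          gcongr
          exact sum_indicator_Ioo_rpow_le hranti _ _ (by linarith) _
      _ = ∑ k ∈ Finset.Ico m N, ∫⁻ x, Q x * (Ioo (r (k + 1)) (r k)).indicator
            (fun _ => ENNReal.ofReal (c k) ^ a) (dist x x₀) ∂ν :=
          lintegral_finsetSum' _ fun k _ => hQ.mul
            ((measurable_const.indicator measurableSet_Ioo).comp
              (continuous_id.dist continuous_const).measurable).aemeasurable
      _ ≤ ∑ k ∈ Finset.Ico m N, ENNReal.ofReal (η * 2 ^ a / S * (1 / k)) :=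
          Finset.sum_le_sum hterm
      _ = δ' := by
          rw [← ENNReal.ofReal_sum_of_nonneg fun k _ => by positivity, ← Finset.mul_sum, ← hSdef,
            hη, div_mul_cancel₀ _ hS0.ne',
            div_mul_cancel₀ _ (by positivity),
            ENNReal.ofReal_coe_nnreal]

/-- Bounded means of `Q` over small balls and regularity of the measure control the integrals of
`Q` over small balls. -/
theorem eventually_setLIntegral_ball_le {X : Type*} [MetricSpace X] [MeasurableSpace X]
    [BorelSpace X] {μ : Measure X} {D : Set X} {x₀ : X} {a : ℝ} {lam : ℝ → ℝ}
    (hreg : UpperRegularAt μ lam x₀)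
    (hlam : lam =o[𝓝[>] (0 : ℝ)] fun ε : ℝ => ε ^ a * Real.log (1 / ε) ^ (a - 1))
    {Q : X → ℝ≥0∞}
    (hmean : limsup (fun ε : ℝ => (∫⁻ x in Metric.ball x₀ ε ∩ D, Q x ∂μ) /
      μ (Metric.ball x₀ ε ∩ D)) (𝓝[>] (0 : ℝ)) < ⊤) {η : ℝ} (hη : 0 < η) :
    ∀ᶠ ε in 𝓝[>] (0 : ℝ), ∫⁻ x in Metric.ball x₀ ε, Q x ∂(μ.restrict D) ≤
      ENNReal.ofReal (η * (ε ^ a * Real.log (1 / ε) ^ (a - 1))) := by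
  obtain ⟨C, hC, r₀, hr₀, -, hμ⟩ := hreg
  obtain ⟨K, hK, -⟩ := ENNReal.lt_iff_exists_nnreal_btwn.1 hmean
  -- `K + 1` because `K` may be `0`.
  have hc : 0 < η / ((K + 1) * C) := by positivity
  filter_upwards [eventually_lt_of_limsup_lt hK, hlam.def hc,
    Ioo_mem_nhdsGT hr₀, Ioo_mem_nhdsGT one_pos] with ε hKε hlamε hε hε1
  have hlog : 0 ≤ Real.log (1 / ε) := Real.log_nonneg ((one_le_div hε1.1).2 hε1.2.le)
  set b : ℝ := ε ^ a * Real.log (1 / ε) ^ (a - 1) with hb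
  have hb0 : 0 ≤ b :=
    mul_nonneg (Real.rpow_nonneg hε.1.le _) (Real.rpow_nonneg hlog _)
  have hlamb : lam ε ≤ η / ((K + 1) * C) * b := by
    have := (le_abs_self (lam ε)).trans hlamε
    rwa [Real.norm_of_nonneg hb0] at this
  have hball : μ (Metric.ball x₀ ε ∩ D) ≤ ENNReal.ofReal (C * lam ε) :=
    (measure_mono inter_subset_left).trans (hμ ε hε)
  rw [Measure.restrict_restrict Metric.isOpen_ball.measurableSet]
  -- Null sets are harmless, as `K` is finite; upper regularity excludes an infinite denominator.
  have hint : ∫⁻ x in Metric.ball x₀ ε ∩ D, Q x ∂μ ≤ K * μ (Metric.ball x₀ ε ∩ D) :=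
    (ENNReal.div_le_iff_le_mul (Or.inr ENNReal.coe_ne_top)
      (Or.inl (hball.trans_lt ENNReal.ofReal_lt_top).ne)).1 hKε.le
  calc ∫⁻ x in Metric.ball x₀ ε ∩ D, Q x ∂μ
      ≤ K * ENNReal.ofReal (C * lam ε) := hint.trans (by gcongr)
    _ = ENNReal.ofReal (K * (C * lam ε)) := by
        rw [ENNReal.ofReal_mul K.coe_nonneg, ENNReal.ofReal_coe_nnreal]
    _ ≤ ENNReal.ofReal (η * b) := by
        refine ENNReal.ofReal_le_ofReal ?_
        calc (K : ℝ) * (C * lam ε) ≤ K * (C * (η / ((K + 1) * C) * b)) := by gcongr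
          _ = K / (K + 1) * (η * b) := by field_simp
          _ ≤ 1 * (η * b) := by
              gcongr
              rw [div_le_one (by positivity)]
              linarith
          _ = η * b := one_mul _

/-! ### Cluster points and path families -/

theorem IsPreconnected.inter_frontier_nonempty_of_mem_of_notMem {X : Type*} [TopologicalSpace X]
    {F U : Set X} (hF : IsPreconnected F) {x y : X} (hx : x ∈ F) (hxU : x ∈ U) (hy : y ∈ F)
    (hyU : y ∉ U) : (F ∩ frontier U).Nonempty := by
  by_contra hemp
  have hfr : ∀ z ∈ F, z ∉ frontier U := fun z hz hzU => hemp ⟨z, hz, hzU⟩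
  have hsplit : ∀ z ∈ F, z ∈ closure U → z ∈ interior U := fun z hz hzc => by
    by_contra hzi
    exact hfr z hz ⟨hzc, hzi⟩
  obtain ⟨z, -, hzi, hzc⟩ := hF (interior U) (closure U)ᶜ isOpen_interior
    isClosed_closure.isOpen_compl
    (fun z hz => or_iff_not_imp_right.2 fun h => hsplit z hz (not_not.1 h))
    ⟨x, hx, hsplit x hx (subset_closure hxU)⟩
    ⟨y, hy, fun h => hyU (interior_subset (hsplit y hy h))⟩
  exact hzc (interior_subset_closure hzi)

/-- A homeomorphism onto an open set sends a boundary point of its domain to boundary points. -/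
theorem Homeomorph.mem_frontier_of_mapClusterPt {X X' : Type*} [TopologicalSpace X] [T2Space X]
    [TopologicalSpace X'] {D : Set X} {D' : Set X'} (hD' : IsOpen D') (f : D ≃ₜ D') {x₀ : X}
    (hx₀ : x₀ ∉ D) {y : X'}
    (hy : MapClusterPt y (comap ((↑) : D → X) (𝓝 x₀)) fun x : D => (f x : X')) :
    y ∈ frontier D' := by
  rw [hD'.frontier_eq]
  have hcl : y ∈ closure D' :=
    mem_closure_iff_clusterPt.2 <| ClusterPt.mono hy <| by
      rw [le_principal_iff, mem_map]
      exact univ_mem' fun x => (f x).2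
  refine ⟨hcl, fun hyD' => hx₀ ?_⟩
  have hyf : MapClusterPt (⟨y, hyD'⟩ : D') (comap ((↑) : D → X) (𝓝 x₀)) f := by
    rw [mapClusterPt_iff_frequently]
    intro s hs
    have hs' : (↑) '' s ∈ 𝓝 y := hD'.isOpenMap_subtype_val.image_mem_nhds (x := ⟨y, hyD'⟩) hs
    refine (mapClusterPt_iff_frequently.1 hy _ hs').mono ?_
    rintro x ⟨z, hz, hzx⟩
    rwa [← Subtype.ext hzx]
  -- Pulled back by `f.symm`, a cluster point inside `D'` gives a cluster point of the inclusion at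
  -- `x₀`, which can only be `x₀` itself.
  have hxc : MapClusterPt (f.symm ⟨y, hyD'⟩ : X) (comap ((↑) : D → X) (𝓝 x₀)) ((↑) : D → X) := by
    have hcont : Continuous fun z : D' => (f.symm z : X) := by fun_prop
    simpa [Function.comp_def] using hyf.continuousAt_comp hcont.continuousAt
  have hlim : Tendsto ((↑) : D → X) (comap (↑) (𝓝 x₀)) (𝓝 x₀) := tendsto_comap
  have hne : (𝓝 (f.symm ⟨y, hyD'⟩ : X) ⊓ 𝓝 x₀).NeBot := ClusterPt.mono hxc hlim
  rw [← eq_of_nhds_neBot hne]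
  exact (f.symm ⟨y, hyD'⟩).2

/-- Presents the family as an image under `f`, the form the `Q`-inequality requires. -/
theorem image_comp_joiningPaths {X X' : Type*} [TopologicalSpace X] [TopologicalSpace X']
    {D : Set X} {D' : Set X'} (f : D ≃ₜ D') (E F : Set X') :
    (fun γ : C(I, D) => (f : C(D, D')).comp γ) ''
      {γ | (f (γ 0) : X') ∈ E ∧ (f (γ 1) : X') ∈ F} = joiningPaths E F D' := by
  ext γ
  constructor
  · rintro ⟨γ, hγ, rfl⟩
    exact hγ
  · intro hγ
    refine ⟨(f.symm : C(D', D)).comp γ, ?_, ?_⟩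
    · simpa [joiningPaths] using hγ
    · ext t
      simp

/-- The modulus of the paths joining a fixed compact set of `D'` to a set whose preimage is close
to `x₀` is small. -/
theorem exists_pathModulus_joiningPaths_lt {X X' : Type*}
    [MetricSpace X] [MeasurableSpace X] [BorelSpace X] [MetricSpace X'] [MeasurableSpace X']
    {μ : Measure X} {μ' : Measure X'} {D : Set X} {D' : Set X'} {x₀ : X} (hx₀ : x₀ ∉ D)
    {Q : X → ℝ≥0∞} (hQ : AEMeasurable Q (μ.restrict D)) (hdim : 1 ≤ (dimH D).toReal)
    (hsmall : ∀ η > (0 : ℝ), ∀ᶠ ε in 𝓝[>] (0 : ℝ),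
      ∫⁻ x in Metric.ball x₀ ε, Q x ∂(μ.restrict D) ≤ ENNReal.ofReal
        (η * (ε ^ (dimH D).toReal * Real.log (1 / ε) ^ ((dimH D).toReal - 1))))
    {f : D ≃ₜ D'} (hf : IsQHomeomorphism μ μ' Q f) {E : Set X'} (hED : E ⊆ D')
    (hE : IsCompact E) {δ : ℝ≥0∞} (hδ : 0 < δ) :
    ∃ r > (0 : ℝ), ∀ F : Set X', (∀ x : D, (f x : X') ∈ F → dist (x : X) x₀ ≤ r) →
      pathModulus μ' (joiningPaths E F D') < δ := by
  have hpre : IsCompact ((fun y : D' => (f.symm y : X)) '' ((↑) ⁻¹' E)) := by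
    refine IsCompact.image ?_ (by fun_prop)
    rw [Subtype.isCompact_iff, Subtype.image_preimage_coe, inter_eq_right.2 hED]
    exact hE
  obtain ⟨R, hR, hRdisj⟩ : ∃ R > (0 : ℝ), ∀ x : D, (f x : X') ∈ E → R ≤ dist (x : X) x₀ := by
    have hmem : ((fun y : D' => (f.symm y : X)) '' ((↑) ⁻¹' E))ᶜ ∈ 𝓝 x₀ := by
      refine hpre.isClosed.isOpen_compl.mem_nhds ?_
      rintro ⟨y, -, hy⟩
      exact hx₀ (hy ▸ (f.symm y).2)
    obtain ⟨R, hR, hball⟩ := Metric.mem_nhds_iff.1 hmem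
    refine ⟨R, hR, fun x hx => le_of_not_gt fun hlt => hball (Metric.mem_ball.2 hlt) ?_⟩
    exact ⟨f x, hx, by simp⟩
  obtain ⟨r, hr, g, hg, hg1, hgδ⟩ := exists_radial_density hQ hdim hsmall hδ hR
  refine ⟨r, hr, fun F hF => ?_⟩
  rw [← image_comp_joiningPaths f E F]
  refine (hf _ (fun x => g (dist x x₀)) ⟨?_, ?_⟩).trans_lt hgδ
  · exact hg.comp (continuous_id.dist continuous_const).measurable
  · rintro γ ⟨h0, h1⟩ hlen
    exact hg1.trans (lintegral_le_lineIntegral_radial (by fun_prop) hlen x₀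
      (hRdisj _ h0) (hF _ h1) hg)

/-! ### Uniqueness of the cluster point and the extension -/

theorem theorem3p1 {X X' : Type*}
    [MetricSpace X] [MeasurableSpace X] [BorelSpace X]
    [MetricSpace X'] [MeasurableSpace X'] [BorelSpace X']
    (μ : Measure X) [IsLocallyFiniteMeasure μ]
    (μ' : Measure X') [IsLocallyFiniteMeasure μ']
    (D : Set X) (D' : Set X') (hD : IsDomainSet D) (hD' : IsDomainSet D')
    (α α' : ℝ≥0) (hα : dimH D = α) (hα' : dimH D' = α')
    (x₀ : X) (hx₀ : x₀ ∈ frontier D) (hloc : LocallyPathConnectedAt D x₀)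
    (lam : ℝ → ℝ) (hreg : UpperRegularAt μ lam x₀)
    (hlam : lam =o[𝓝[>] (0 : ℝ)]
      fun ε : ℝ => ε ^ (α : ℝ) * Real.log (1 / ε) ^ ((α : ℝ) - 1))
    (hcomp : IsCompact (closure D')) (hacc : StronglyAccessibleBoundary μ' D')
    (Q : X → ℝ≥0∞) (hQ : AEMeasurable Q (μ.restrict D))
    (hmean : limsup (fun ε : ℝ => (∫⁻ x in Metric.ball x₀ ε ∩ D, Q x ∂μ) /
      μ (Metric.ball x₀ ε ∩ D)) (𝓝[>] (0 : ℝ)) < ⊤)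
    (f : D ≃ₜ D') (hf : IsQHomeomorphism μ μ' Q f) :
    ∃ g : X → X', (∀ x : D, g x = f x) ∧ ContinuousOn g (insert x₀ D) := by
  have hx₀D : x₀ ∉ D := (hD.1.frontier_eq ▸ hx₀).2
  have hx₀cl : x₀ ∈ closure D := frontier_subset_closure hx₀
  have hdimα : (dimH D).toReal = α := by simp [hα]
  have hdim : 1 ≤ (dimH D).toReal := by
    have hnt : D.Nontrivial := by
      rw [← not_subsingleton_iff]
      intro hs
      -- A subsingleton is closed, so it would contain `x₀`.
      exact hx₀D (hs.finite.isClosed.closure_eq ▸ hx₀cl)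
    have := hD.2.isConnected.isPreconnected.one_le_dimH hnt
    rw [hα] at this ⊢
    exact_mod_cast this
  have hsmall : ∀ η > (0 : ℝ), ∀ᶠ ε in 𝓝[>] (0 : ℝ),
      ∫⁻ x in Metric.ball x₀ ε, Q x ∂(μ.restrict D) ≤ ENNReal.ofReal
        (η * (ε ^ (dimH D).toReal * Real.log (1 / ε) ^ ((dimH D).toReal - 1))) := by
    rw [hdimα]
    exact fun η hη => eventually_setLIntegral_ball_le hreg hlam hmean hη
  set l : Filter D := comap (↑) (𝓝 x₀) with hl
  have hlne : l.NeBot := mem_closure_iff_comap_neBot.1 hx₀cl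
  set F : D → X' := fun x => (f x : X') with hF
  have hFcont : Continuous F := by fun_prop
  have hmem : closure D' ∈ map F l := mem_map.2 (univ_mem' fun x => subset_closure (f x).2)
  have huniq : ∀ y z, MapClusterPt y l F → MapClusterPt z l F → z = y := by
    intro y z hy hz
    by_contra hne
    have hyz : 0 < dist z y := dist_pos.2 hne
    have hyfr := Homeomorph.mem_frontier_of_mapClusterPt hD'.1 f hx₀D hy
    obtain ⟨E, hED, hE, V, hV, hVU, δ, hδ, hacc'⟩ :=
      hacc y hyfr (Metric.ball y (dist z y / 2)) (Metric.ball_mem_nhds _ (by positivity))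
    obtain ⟨r, hr, hmod⟩ :=
      exists_pathModulus_joiningPaths_lt hx₀D hQ hdim hsmall hf hED hE hδ
    obtain ⟨W, hW, hWr, hWD⟩ := hloc _ (Metric.ball_mem_nhds x₀ hr)
    have hWl : ((↑) ⁻¹' W : Set D) ∈ l := preimage_mem_comap hW
    obtain ⟨p, hpV, hpW⟩ :=
      ((mapClusterPt_iff_frequently.1 hy V hV).and_eventually hWl).exists
    obtain ⟨q, hqU, hqW⟩ := ((mapClusterPt_iff_frequently.1 hz _
      (Metric.ball_mem_nhds z (half_pos hyz))).and_eventually hWl).exists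
    -- The half-distance balls around `y` and `z` are disjoint.
    have hqU' : F q ∉ Metric.ball y (dist z y / 2) := by
      intro hq
      have h1 := Metric.mem_ball.1 hqU
      have h2 := Metric.mem_ball.1 hq
      have h3 := dist_triangle_left z y (F q)
      linarith
    obtain ⟨c, hc⟩ := hWD.joinedIn p ⟨hpW, p.2⟩ q ⟨hqW, q.2⟩
    set τ : I → D := fun t => ⟨c t, (hc t).2⟩ with hτ
    have hτc : Continuous τ := by fun_prop
    have hτ0 : τ 0 = p := Subtype.ext (by simp [hτ])
    have hτ1 : τ 1 = q := Subtype.ext (by simp [hτ])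
    have hconn : IsConnected (range (F ∘ τ)) := isConnected_range (hFcont.comp hτc)
    have hpmem : F p ∈ range (F ∘ τ) := ⟨0, by simp [hτ0]⟩
    have hqmem : F q ∈ range (F ∘ τ) := ⟨1, by simp [hτ1]⟩
    refine (hacc' (range (F ∘ τ)) ?_ (isCompact_range (hFcont.comp hτc)) hconn ?_ ?_).not_gt
      (hmod _ ?_)
    · rintro _ ⟨t, rfl⟩
      exact (f (τ t)).2
    · exact hconn.isPreconnected.inter_frontier_nonempty_of_mem_of_notMem hpmem (hVU hpV)
        hqmem hqU'
    · exact hconn.isPreconnected.inter_frontier_nonempty_of_mem_of_notMem hpmem hpV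
        hqmem fun h => hqU' (hVU h)
    -- By injectivity of `f`, only points of the curve `c`, which stays in `W`, map into the
    -- continuum.
    · rintro x ⟨t, ht⟩
      have hx : τ t = x := f.injective (Subtype.ext ht)
      rw [← hx]
      exact (Metric.mem_ball.1 (hWr (hc t).1)).le
  obtain ⟨y, -, hy⟩ := hcomp.exists_clusterPt (le_principal_iff.2 hmem)
  have hlim : Tendsto F l (𝓝 y) :=
    hcomp.le_nhds_of_unique_clusterPt hmem fun z _ hz => huniq y z hy hz
  classical
  refine ⟨fun x => if hx : x ∈ D then F ⟨x, hx⟩ else y, fun x => by simp [hF], ?_⟩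
  set g : X → X' := fun x => if hx : x ∈ D then F ⟨x, hx⟩ else y with hg
  have hgF : g ∘ ((↑) : D → X) = F := by
    ext x
    simp [hg]
  have hgD : ContinuousOn g D := by
    rw [continuousOn_iff_continuous_domRestrict]
    change Continuous (g ∘ ((↑) : D → X))
    rwa [hgF]
  intro x hx
  rcases hx with rfl | hx
  · rw [continuousWithinAt_insert_self, ContinuousWithinAt, show g x = y from dif_neg hx₀D,
      nhdsWithin, ← map_comap_setCoe_val, tendsto_map'_iff, hgF]
    exact hlim
  · exact (hgD.continuousAt (hD.1.mem_nhds hx)).continuousWithinAt
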